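/- Let $A>0$ and let $b=(b_t)_{t\ge 0}$ be a standard Brownian motion on a probability space. For $\varepsilon>0$ let $v^\varepsilon$ be the velocity process and $x^\varepsilon$ the displacement process (integrated Ornstein--Uhlenbeck process) that solve, with zero initial conditions, \[ v^\varepsilon_t=-A\int_0^t v^\varepsilon_s\,\mathrm ds+\varepsilon b_t,\qquad x^\varepsilon_t=\int_0^t v^\varepsilon_s\,\mathrm ds,\qquad t\ge 0, \] almost surely. For a path $y=(y_t)_{t\ge0}$ and a level $c>0$ let $\tau_c(y)=\inf\{t\ge 0: y_t>c\}\in[0,\infty]$ be the first passage time over $c$ (with $\inf\emptyset=\infty$). Then for every $a>0$ \[ \varepsilon^2\,\tau_a(x^\varepsilon)\ \xrightarrow{\ d\ }\ \tau_{aA}(b)\qquad\text{as }\varepsilon\downarrow 0, \] where $\xrightarrow{d}$ is convergence in distribution of $[0,\infty]$-valued random variables. -/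

import Mathlib

open Set Filter Topology MeasureTheory ProbabilityTheory
open scoped NNReal ENNReal

/-- The paths `v` (velocity) and `x` (displacement) solve the Langevin system with friction
coefficient `A`, driving path `l` of amplitude `ε` and initial values `v₀`, `x₀`:
`v_t = v₀ - A ∫₀ᵗ v_s ds + ε l_t` and `x_t = x₀ + ∫₀ᵗ v_s ds` for all `t ≥ 0`.
Paths are indexed by `ℝ≥0`; under the integral sign `s` runs through `[0, t]` as a real number.
The first field makes sure that the integrals are genuine. -/
structure IsLangevinPath (A ε v₀ x₀ : ℝ) (l v x : ℝ≥0 → ℝ) : Prop where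
  intervalIntegrable : ∀ t : ℝ≥0,
    IntervalIntegrable (fun s : ℝ => v s.toNNReal) volume 0 (t : ℝ)
  velocity : ∀ t : ℝ≥0,
    v t = v₀ - A * (∫ s in (0 : ℝ)..(t : ℝ), v s.toNNReal) + ε * l t
  displacement : ∀ t : ℝ≥0,
    x t = x₀ + ∫ s in (0 : ℝ)..(t : ℝ), v s.toNNReal

/-- The first passage time `inf {t ≥ 0 : y_t > a}` of a path `y` over the level `a`, with values
in `[0, ∞]` (the infimum of the empty set is `∞`). -/
noncomputable def firstPassageTime (a : ℝ) (y : ℝ≥0 → ℝ) : ℝ≥0∞ :=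
  ⨅ (t : ℝ≥0) (_ : a < y t), (t : ℝ≥0∞)

/-! Variation of constants gives `A * x t = ε * expAverage A⁻¹ b t`, so after Brownian scaling `ε²
τ_a(x)` is the passage time over `aA` of the average, at time scale `ε² / A`, of a rescaled Brownian
motion (`IsLangevinPath.firstPassageTime_eq`). Its law is unchanged when that motion is replaced by
the fixed `b` (`identDistrib_firstPassageTime_expAverage`). For fixed continuous `b` the passage
times converge pathwise as the scale tends to `0` (`tendsto_firstPassageTime_expAverage`): averaging
only delays passage, and wherever `b` exceeds the level, so do its averages at small scales. -/

/-- The exponentially weighted average of the past of `w` before time `t`, at time scale `κ`. -/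
noncomputable def expAverage (κ : ℝ≥0) (w : ℝ≥0 → ℝ) (t : ℝ≥0) : ℝ :=
  ∫ r in Ioi (0 : ℝ), Real.exp (-r) * w (t - κ * r.toNNReal)

@[simp]
lemma expAverage_zero (w : ℝ≥0 → ℝ) (t : ℝ≥0) : expAverage 0 w t = w t := by
  simp only [expAverage, zero_mul, tsub_zero]
  rw [integral_mul_const, integral_exp_neg_Ioi_zero, one_mul]

lemma exists_bound_of_continuous {w : ℝ≥0 → ℝ} (hw : Continuous w) (T : ℝ≥0) :
    ∃ M, ∀ s ≤ T, |w s| ≤ M := by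
  obtain ⟨M, hM⟩ := (isCompact_Icc (a := (0 : ℝ≥0)) (b := T)).exists_bound_of_continuousOn
    hw.continuousOn
  exact ⟨M, fun s hs ↦ hM s ⟨zero_le, hs⟩⟩

lemma integrableOn_expAverage {w : ℝ≥0 → ℝ} (hw : Continuous w) (κ t : ℝ≥0) :
    IntegrableOn (fun r : ℝ ↦ Real.exp (-r) * w (t - κ * r.toNNReal)) (Ioi 0) := by
  obtain ⟨M, hM⟩ := exists_bound_of_continuous hw t
  refine ((integrableOn_exp_neg_Ioi 0).mul_const M).mono'
    (by fun_prop : Continuous _).aestronglyMeasurable (ae_of_all _ fun r ↦ ?_)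
  rw [norm_mul, Real.norm_of_nonneg (Real.exp_pos _).le]
  exact mul_le_mul_of_nonneg_left (hM _ tsub_le_self) (Real.exp_pos _).le

lemma continuous_expAverage_prod {w : ℝ≥0 → ℝ} (hw : Continuous w) :
    Continuous fun p : ℝ≥0 × ℝ≥0 ↦ expAverage p.1 w p.2 := by
  rw [continuous_iff_continuousAt]
  intro p₀
  obtain ⟨M, hM⟩ := exists_bound_of_continuous hw (p₀.2 + 1)
  have hnear : ∀ᶠ p : ℝ≥0 × ℝ≥0 in 𝓝 p₀, p.2 < p₀.2 + 1 :=
    continuous_snd.continuousAt.eventually_lt continuousAt_const (lt_add_one _)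
  refine continuousAt_of_dominated (bound := fun r ↦ Real.exp (-r) * M)
    (.of_forall fun p ↦ (by fun_prop : Continuous _).aestronglyMeasurable) ?_
    ((integrableOn_exp_neg_Ioi 0).mul_const M)
    (ae_of_all _ fun r ↦ (by fun_prop : Continuous _).continuousAt)
  filter_upwards [hnear] with p hp
  refine ae_of_all _ fun r ↦ ?_
  rw [norm_mul, Real.norm_of_nonneg (Real.exp_pos _).le]
  exact mul_le_mul_of_nonneg_left (hM _ (tsub_le_self.trans hp.le)) (Real.exp_pos _).le

lemma continuous_expAverage {w : ℝ≥0 → ℝ} (hw : Continuous w) (κ : ℝ≥0) :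
    Continuous (expAverage κ w) :=
  (continuous_expAverage_prod hw).comp (Continuous.prodMk_right κ)

lemma expAverage_le {w : ℝ≥0 → ℝ} (hw : Continuous w) (κ : ℝ≥0) {t : ℝ≥0} {c : ℝ}
    (h : ∀ s ≤ t, w s ≤ c) : expAverage κ w t ≤ c := by
  calc expAverage κ w t ≤ ∫ r in Ioi (0 : ℝ), Real.exp (-r) * c :=
        setIntegral_mono (integrableOn_expAverage hw κ t)
          ((integrableOn_exp_neg_Ioi 0).mul_const c)
          fun r ↦ mul_le_mul_of_nonneg_left (h _ tsub_le_self) (Real.exp_pos _).le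
    _ = c := by rw [integral_mul_const, integral_exp_neg_Ioi_zero, one_mul]

/-! ### First passage times -/

lemma firstPassageTime_le {c : ℝ} {y : ℝ≥0 → ℝ} {t : ℝ≥0} (h : c < y t) :
    firstPassageTime c y ≤ t := iInf₂_le t h

lemma firstPassageTime_lt_iff {c : ℝ} {y : ℝ≥0 → ℝ} {r : ℝ≥0∞} :
    firstPassageTime c y < r ↔ ∃ t : ℝ≥0, c < y t ∧ (t : ℝ≥0∞) < r := by
  simp [firstPassageTime, iInf_lt_iff]

lemma firstPassageTime_le_expAverage {w : ℝ≥0 → ℝ} (hw : Continuous w) (κ : ℝ≥0) (c : ℝ) :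
    firstPassageTime c w ≤ firstPassageTime c (expAverage κ w) := by
  refine le_iInf₂ fun t ht ↦ ?_
  obtain ⟨s, hst, hs⟩ : ∃ s ≤ t, c < w s := by
    by_contra! h
    exact ht.not_ge (expAverage_le hw κ h)
  exact (firstPassageTime_le hs).trans (by exact_mod_cast hst)

lemma tendsto_firstPassageTime_expAverage {w : ℝ≥0 → ℝ} (hw : Continuous w) (c : ℝ) :
    Tendsto (fun κ ↦ firstPassageTime c (expAverage κ w)) (𝓝 0) (𝓝 (firstPassageTime c w)) := by
  refine tendsto_order.2 ⟨fun r hr ↦ .of_forall fun κ ↦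
    hr.trans_le (firstPassageTime_le_expAverage hw κ c), fun r hr ↦ ?_⟩
  obtain ⟨t, ht, htr⟩ := firstPassageTime_lt_iff.1 hr
  have hlim : Tendsto (fun κ ↦ expAverage κ w t) (𝓝 0) (𝓝 (w t)) := by
    have h := ((continuous_expAverage_prod hw).comp (Continuous.prodMk_left t)).tendsto 0
    simpa [Function.comp_def] using h
  filter_upwards [hlim.eventually_const_lt ht] with κ hκ
  exact (firstPassageTime_le hκ).trans_lt htr

lemma firstPassageTime_comp_mul {η : ℝ≥0} (hη : η ≠ 0) (c : ℝ) (y : ℝ≥0 → ℝ) :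
    firstPassageTime c (fun t ↦ y (η⁻¹ * t)) = η * firstPassageTime c y := by
  have hη' : (η : ℝ≥0∞) ≠ 0 := by exact_mod_cast hη
  simp_rw [firstPassageTime, ENNReal.mul_iInf_of_ne hη' ENNReal.coe_ne_top]
  refine le_antisymm (le_iInf₂ fun t ht ↦ ?_) (le_iInf₂ fun t ht ↦ ?_)
  · refine (iInf₂_le (η * t) (by rwa [inv_mul_cancel_left₀ hη])).trans (by simp)
  · refine (iInf₂_le (η⁻¹ * t) ht).trans ?_
    rw [← ENNReal.coe_mul, mul_inv_cancel_left₀ hη]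

/-! ### Measurability through a countable grid -/

/-- Points `k / n` enumerating the nonnegative rationals. -/
noncomputable def gridPoint (p : ℕ × ℕ) : ℝ≥0 := p.2 / p.1

lemma tendsto_gridPoint_floor (s : ℝ≥0) :
    Tendsto (fun n : ℕ ↦ gridPoint (n, ⌊s * n⌋₊)) atTop (𝓝 s) := by
  rw [← NNReal.tendsto_coe]
  have h := (tendsto_nat_floor_mul_div_atTop (R := ℝ) s.2).comp tendsto_natCast_atTop_atTop
  refine h.congr fun n ↦ ?_
  have : ⌊(s : ℝ) * n⌋₊ = ⌊s * n⌋₊ := by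
    refine eq_of_forall_le_iff fun k ↦ ?_
    rw [Nat.le_floor_iff (by positivity), Nat.le_floor_iff zero_le]
    norm_cast
  simp [gridPoint, this]

lemma denseRange_gridPoint : DenseRange gridPoint := fun s ↦
  mem_closure_of_tendsto (tendsto_gridPoint_floor s) (.of_forall fun _ ↦ mem_range_self _)

/-- Reconstruction of a continuous path from its values at the grid points. -/
noncomputable def pathOfGrid (z : ℕ × ℕ → ℝ) (s : ℝ≥0) : ℝ :=
  limsup (fun n : ℕ ↦ z (n, ⌊s * n⌋₊)) atTop

lemma pathOfGrid_comp {w : ℝ≥0 → ℝ} (hw : Continuous w) : pathOfGrid (w ∘ gridPoint) = w :=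
  funext fun s ↦ ((hw.tendsto s).comp (tendsto_gridPoint_floor s)).limsup_eq

/-- A limsup stays measurable without continuity of the path; joint measurability in path and time
is what the integral in `expAverage` needs. -/
lemma Measurable.pathOfGrid {α : Type*} [MeasurableSpace α] {f : α → ℕ × ℕ → ℝ}
    {g : α → ℝ≥0} (hf : Measurable f) (hg : Measurable g) :
    Measurable fun a ↦ pathOfGrid (f a) (g a) := by
  refine Measurable.limsup fun n ↦ ?_
  have h : Measurable fun q : (ℕ × ℕ → ℝ) × ℕ ↦ q.1 (n, q.2) :=
    measurable_from_prod_countable_left fun k ↦ measurable_pi_apply (n, k)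
  exact h.comp (hf.prodMk (Nat.measurable_floor.comp (hg.mul_const _)))

/-- Strict passage is an open condition on the time, so the dense grid detects it. -/
lemma firstPassageTime_eq_iInf_grid {y : ℝ≥0 → ℝ} (hy : Continuous y) (c : ℝ) :
    firstPassageTime c y =
      ⨅ p, if c < y (gridPoint p) then (gridPoint p : ℝ≥0∞) else ⊤ := by
  refine le_antisymm (le_iInf fun p ↦ ?_) (le_of_forall_gt fun r hr ↦ ?_)
  · split_ifs with h
    · exact firstPassageTime_le h
    · exact le_top
  · obtain ⟨t, ht, htr⟩ := firstPassageTime_lt_iff.1 hr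
    have hopen : IsOpen {s : ℝ≥0 | c < y s ∧ (s : ℝ≥0∞) < r} :=
      (isOpen_lt continuous_const hy).inter (isOpen_lt ENNReal.continuous_coe continuous_const)
    obtain ⟨p, hp, hpr⟩ := denseRange_gridPoint.exists_mem_open hopen ⟨t, ht, htr⟩
    exact (iInf_le _ p).trans_lt (by rwa [if_pos hp])

/-- The first passage time of the exponential average of a path, as a function of the values of
the path on the grid. -/
noncomputable def gridPassageTime (c : ℝ) (κ : ℝ≥0) (z : ℕ × ℕ → ℝ) : ℝ≥0∞ :=
  ⨅ p, if c < expAverage κ (pathOfGrid z) (gridPoint p) then (gridPoint p : ℝ≥0∞) else ⊤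

lemma measurable_gridPassageTime (c : ℝ) (κ : ℝ≥0) : Measurable (gridPassageTime c κ) := by
  refine Measurable.iInf fun p ↦ Measurable.ite ?_ measurable_const measurable_const
  refine measurableSet_lt measurable_const (StronglyMeasurable.measurable ?_)
  have hmeas : Measurable fun q : (ℕ × ℕ → ℝ) × ℝ ↦
      Real.exp (-q.2) * pathOfGrid q.1 (gridPoint p - κ * q.2.toNNReal) := by
    have hexp : Measurable fun q : (ℕ × ℕ → ℝ) × ℝ ↦ Real.exp (-q.2) := by fun_prop
    have htime : Measurable fun q : (ℕ × ℕ → ℝ) × ℝ ↦ gridPoint p - κ * q.2.toNNReal := by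
      fun_prop
    have hpath : Measurable fun q : (ℕ × ℕ → ℝ) × ℝ ↦
        pathOfGrid q.1 (gridPoint p - κ * q.2.toNNReal) :=
      measurable_fst.pathOfGrid htime
    exact hexp.mul hpath
  exact hmeas.stronglyMeasurable.integral_prod_right'

lemma gridPassageTime_comp {w : ℝ≥0 → ℝ} (hw : Continuous w) (c : ℝ) (κ : ℝ≥0) :
    gridPassageTime c κ (w ∘ gridPoint) = firstPassageTime c (expAverage κ w) := by
  rw [gridPassageTime, pathOfGrid_comp hw,
    firstPassageTime_eq_iInf_grid (continuous_expAverage hw κ)]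

/-! ### Equality of laws -/

section BrownianMotion

variable {Ω : Type*} {mΩ : MeasurableSpace Ω} {P : Measure Ω} {B C : ℝ≥0 → Ω → ℝ}

lemma aemeasurable_grid (hB : IsPreBrownianReal B P) :
    AEMeasurable (fun ω p ↦ B (gridPoint p) ω) P :=
  aemeasurable_pi_lambda _ fun _ ↦ hB.aemeasurable _

lemma identDistrib_grid [IsProbabilityMeasure P] (hB : IsPreBrownianReal B P)
    (hC : IsPreBrownianReal C P) :
    IdentDistrib (fun ω p ↦ B (gridPoint p) ω) (fun ω p ↦ C (gridPoint p) ω) P P := by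
  refine (identDistrib_iff_forall_finset_identDistrib (X := fun p ↦ B (gridPoint p))
    (Y := fun p ↦ C (gridPoint p)) (aemeasurable_grid hB) (aemeasurable_grid hC)).2 fun I ↦ ?_
  -- `gridPoint` is not injective, hence the comparison on the image of `I`, followed by pullback.
  have h : IdentDistrib (fun ω ↦ (I.image gridPoint).restrict (B · ω))
      (fun ω ↦ (I.image gridPoint).restrict (C · ω)) P P :=
    ⟨(hB.hasLaw _).aemeasurable, (hC.hasLaw _).aemeasurable,
      (hB.hasLaw _).map_eq.trans (hC.hasLaw _).map_eq.symm⟩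
  exact h.comp (u := fun z (i : I) ↦ z ⟨gridPoint i, Finset.mem_image_of_mem _ i.2⟩)
    (by fun_prop)

lemma gridPassageTime_ae_eq (hB : IsBrownianReal B P) (c : ℝ) (κ : ℝ≥0) :
    (fun ω ↦ gridPassageTime c κ fun p ↦ B (gridPoint p) ω) =ᵐ[P]
      fun ω ↦ firstPassageTime c (expAverage κ (B · ω)) := by
  filter_upwards [hB.cont] with ω hω
  exact gridPassageTime_comp hω c κ

lemma identDistrib_firstPassageTime_expAverage [IsProbabilityMeasure P] (hB : IsBrownianReal B P)
    (hC : IsBrownianReal C P) (c : ℝ) (κ : ℝ≥0) :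
    IdentDistrib (fun ω ↦ firstPassageTime c (expAverage κ (B · ω)))
      (fun ω ↦ firstPassageTime c (expAverage κ (C · ω))) P P := by
  have h := (identDistrib_grid hB.toIsPreBrownianReal hC.toIsPreBrownianReal).comp
    (measurable_gridPassageTime c κ)
  have h₁ := gridPassageTime_ae_eq hB c κ
  have h₂ := gridPassageTime_ae_eq hC c κ
  exact ⟨h.aemeasurable_fst.congr h₁, h.aemeasurable_snd.congr h₂,
    (Measure.map_congr h₁).symm.trans (h.map_eq.trans (Measure.map_congr h₂))⟩

end BrownianMotion

/-! ### Langevin paths as exponential averages -/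

/-- Substitute `s = t - r / κ`. For `r > κ * t` the truncated subtraction evaluates `l` at `0`,
where it vanishes. -/
lemma expAverage_inv_eq_intervalIntegral {l : ℝ≥0 → ℝ} (hl0 : l 0 = 0)
    {κ : ℝ≥0} (hκ : κ ≠ 0) (t : ℝ≥0) :
    expAverage κ⁻¹ l t =
      κ * ∫ s in (0 : ℝ)..t, Real.exp (-(κ * (t - s))) * l s.toNNReal := by
  have hκ' : (κ : ℝ) ≠ 0 := by exact_mod_cast hκ
  have hκ0 : (0 : ℝ) < κ := by positivity
  have h := intervalIntegral.integral_comp_sub_div (a := 0) (b := κ * t)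
    (fun s : ℝ ↦ Real.exp (-(κ * (t - s))) * l s.toNNReal) hκ' (t : ℝ)
  rw [mul_div_cancel_left₀ _ hκ', sub_self, zero_div, sub_zero, smul_eq_mul] at h
  rw [← h, expAverage, intervalIntegral.integral_of_le (by positivity)]
  have harg : ∀ r : ℝ, 0 < r → (t - κ⁻¹ * r.toNNReal : ℝ≥0) = ((t : ℝ) - r / κ).toNNReal := by
    intro r hr
    ext
    rw [NNReal.coe_sub_def, Real.coe_toNNReal']
    simp [hr.le, div_eq_inv_mul]
  rw [← setIntegral_eq_of_subset_of_forall_sdiff_eq_zero measurableSet_Ioi Ioc_subset_Ioi_self]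
  · refine setIntegral_congr_fun measurableSet_Ioi fun r hr ↦ ?_
    simp only [harg r hr, sub_sub_cancel, mul_div_cancel₀ _ hκ']
  · rintro r ⟨hr, hr'⟩
    have : (t : ℝ) - r / κ ≤ 0 := by
      rw [sub_nonpos, le_div_iff₀ hκ0, mul_comm]
      by_contra! hlt
      exact hr' ⟨hr, hlt.le⟩
    simp [Real.toNNReal_of_nonpos this, hl0]

lemma IsLangevinPath.displacement_eq {A : ℝ≥0} (hA : A ≠ 0) {ε : ℝ} {l v x : ℝ≥0 → ℝ}
    (h : IsLangevinPath A ε 0 0 l v x) (hl : Continuous l) (hl0 : l 0 = 0) (t : ℝ≥0) :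
    A * x t = ε * expAverage A⁻¹ l t := by
  set f : ℝ → ℝ := fun s ↦ v s.toNNReal with hf
  set X : ℝ → ℝ := fun s ↦ ∫ u in (0 : ℝ)..s, f u with hX
  have hint0 : ∀ s, IntervalIntegrable f volume 0 s := by
    intro s
    rcases le_total 0 s with hs | hs
    · exact h.intervalIntegrable ⟨s, hs⟩
    · refine (intervalIntegrable_const (c := v 0)).congr fun u hu ↦ ?_
      rw [uIoc_of_ge hs] at hu
      simp [hf, Real.toNNReal_of_nonpos hu.2]
  have hXcont : Continuous X :=
    intervalIntegral.continuous_primitive (fun a b ↦ (hint0 a).symm.trans (hint0 b)) 0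
  have hfX : ∀ s, f s = -(A * X s.toNNReal) + ε * l s.toNNReal := by
    intro s
    have := h.velocity s.toNNReal
    simp only [hf, hX, this, zero_sub]
  -- Bootstrap: the velocity equation upgrades integrability of `f` to continuity, so `X` is
  -- differentiable.
  have hfcont : Continuous f := by
    rw [funext hfX]
    fun_prop
  have hderiv : ∀ s, HasDerivAt X (f s) s := fun s ↦
    (hfcont.integral_hasStrictDerivAt 0 s).hasDerivAt
  -- Integrating factor for `X' = -A X + ε l`.
  have hE : ∀ s ∈ uIcc (0 : ℝ) t, HasDerivAt (fun s ↦ Real.exp (-(A * (t - s))) * X s)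
      (Real.exp (-(A * (t - s))) * (ε * l s.toNNReal)) s := by
    intro s hs
    rw [uIcc_of_le t.coe_nonneg] at hs
    have h1 : HasDerivAt (fun s : ℝ ↦ -(A * (t - s))) (A : ℝ) s := by
      simpa using (((hasDerivAt_id' s).const_sub (t : ℝ)).const_mul (A : ℝ)).fun_neg
    refine (h1.exp.fun_mul (hderiv s)).congr_deriv ?_
    rw [hfX s, Real.coe_toNNReal s hs.1]
    ring
  have hFTC := intervalIntegral.integral_eq_sub_of_hasDerivAt hE
    ((by fun_prop : Continuous _).intervalIntegrable _ _)
  have hx : x t = X t := by simpa using h.displacement t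
  rw [expAverage_inv_eq_intervalIntegral hl0 hA, hx]
  have hX0 : X 0 = 0 := by simp [hX]
  simp only [sub_self, mul_zero, neg_zero, Real.exp_zero, one_mul, hX0, sub_zero] at hFTC
  rw [← hFTC, mul_left_comm ε, ← intervalIntegral.integral_const_mul ε]
  congr 2 with s
  ring

/-- Brownian scaling turns exponential averages at one time scale into those at another one. -/
lemma expAverage_scaling (w : ℝ≥0 → ℝ) (q : ℝ) {η : ℝ≥0} (hη : η ≠ 0) (κ t : ℝ≥0) :
    expAverage (η * κ) (fun s ↦ q * w (η⁻¹ * s)) t = q * expAverage κ w (η⁻¹ * t) := by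
  rw [expAverage, expAverage, ← integral_const_mul]
  congr with r
  rw [mul_tsub, mul_assoc η, inv_mul_cancel_left₀ hη]
  ring

lemma IsLangevinPath.firstPassageTime_eq {A ε : ℝ≥0} (hA : A ≠ 0) (hε : ε ≠ 0) {l v x : ℝ≥0 → ℝ}
    (h : IsLangevinPath A ε 0 0 l v x) (hl : Continuous l) (hl0 : l 0 = 0) (a : ℝ) :
    ((ε ^ 2 : ℝ≥0) : ℝ≥0∞) * firstPassageTime a x =
      firstPassageTime (a * A)
        (expAverage (ε ^ 2 * A⁻¹) fun t ↦ ε * l ((ε ^ 2)⁻¹ * t)) := by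
  have hε2 : ε ^ 2 ≠ 0 := pow_ne_zero 2 hε
  have hA0 : (0 : ℝ) < A := by positivity
  have key : expAverage (ε ^ 2 * A⁻¹) (fun t ↦ ε * l ((ε ^ 2)⁻¹ * t)) =
      fun t ↦ A * x ((ε ^ 2)⁻¹ * t) := by
    ext t
    rw [expAverage_scaling l ε hε2, h.displacement_eq hA hl hl0]
  rw [key, ← firstPassageTime_comp_mul hε2]
  simp_rw [firstPassageTime, mul_comm a, mul_lt_mul_iff_right₀ hA0]

theorem mainTheorem7 {Ω : Type*} [MeasurableSpace Ω] (P : Measure Ω) [IsProbabilityMeasure P]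
    (b : ℝ≥0 → Ω → ℝ) (hb : IsBrownianReal b P)
    (A : ℝ) (hA : 0 < A)
    (v x : Set.Ioi (0 : ℝ) → ℝ≥0 → Ω → ℝ)
    (hvx : ∀ ε : Set.Ioi (0 : ℝ), ∀ᵐ ω ∂P,
      IsLangevinPath A (ε : ℝ) 0 0 (fun t => b t ω) (fun t => v ε t ω) (fun t => x ε t ω))
    (a : ℝ) (ha : 0 < a) :
    TendstoInDistribution
      (fun (ε : Set.Ioi (0 : ℝ)) (ω : Ω) =>
        ENNReal.ofReal ((ε : ℝ) ^ 2) * firstPassageTime a (fun t => x ε t ω))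
      (comap ((↑) : Set.Ioi (0 : ℝ) → ℝ) (𝓝 0))
      (fun ω : Ω => firstPassageTime (a * A) (fun t => b t ω))
      (fun _ => P) P := by
  lift A to ℝ≥0 using hA.le
  have hA' : A ≠ 0 := by rintro rfl; simp at hA
  let e : Set.Ioi (0 : ℝ) → ℝ≥0 := fun ε ↦ ⟨ε, (mem_Ioi.1 ε.2).le⟩
  have he : ∀ ε, e ε ≠ 0 := fun ε h ↦ (mem_Ioi.1 ε.2).ne' (congrArg NNReal.toReal h)
  let C : Set.Ioi (0 : ℝ) → ℝ≥0 → Ω → ℝ := fun ε t ω ↦ e ε * b ((e ε ^ 2)⁻¹ * t) ω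
  have hC : ∀ ε, IsBrownianReal (C ε) P := by
    intro ε
    have h := hb.smul (inv_ne_zero (pow_ne_zero 2 (he ε)))
    simpa [C] using h
  have hae : ∀ ε : Set.Ioi (0 : ℝ),
      (fun ω ↦ firstPassageTime (a * A) (expAverage (e ε ^ 2 * A⁻¹) (C ε · ω))) =ᵐ[P]
        fun ω ↦ ENNReal.ofReal ((ε : ℝ) ^ 2) * firstPassageTime a (fun t ↦ x ε t ω) := by
    intro ε
    filter_upwards [hvx ε, hb.cont, hb.eval_zero_ae_eq_zero] with ω h hl hl0
    have hcoe : ENNReal.ofReal ((ε : ℝ) ^ 2) = ((e ε ^ 2 : ℝ≥0) : ℝ≥0∞) := by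
      rw [← ENNReal.ofReal_coe_nnreal]; rfl
    rw [hcoe]
    exact (IsLangevinPath.firstPassageTime_eq (ε := e ε) hA' (he ε) h hl hl0 a).symm
  have hident := fun ε ↦
    identDistrib_firstPassageTime_expAverage hb (hC ε) (a * A) (e ε ^ 2 * A⁻¹)
  have hzero : AEMeasurable (fun ω ↦ firstPassageTime (a * A) (fun t ↦ b t ω)) P := by
    -- Scale `0` is the path itself.
    have h := (identDistrib_firstPassageTime_expAverage hb hb (a * A) 0).aemeasurable_fst
    have h0 : ∀ w : ℝ≥0 → ℝ, expAverage 0 w = w := fun w ↦ funext (expAverage_zero w)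
    simpa only [h0] using h
  have hscale : Tendsto (fun ε ↦ e ε ^ 2 * A⁻¹)
      (comap ((↑) : Set.Ioi (0 : ℝ) → ℝ) (𝓝 0)) (𝓝 0) := by
    have h1 : Tendsto e (comap ((↑) : Set.Ioi (0 : ℝ) → ℝ) (𝓝 0)) (𝓝 0) :=
      NNReal.tendsto_coe.1 tendsto_comap
    simpa using (h1.pow 2).mul_const A⁻¹
  -- Almost sure convergence along the fixed `b`; only the laws are carried over to `x ε`.
  have hlim := tendstoInDistribution_of_ae_tendsto
    (l := comap ((↑) : Set.Ioi (0 : ℝ) → ℝ) (𝓝 0)) (fun ε ↦ (hident ε).aemeasurable_fst) hzero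
    (by
      filter_upwards [hb.cont] with ω hω
      exact (tendsto_firstPassageTime_expAverage hω (a * A)).comp hscale)
  refine TendstoInDistribution.congr hae (ae_eq_refl _)
    ⟨fun ε ↦ (hident ε).aemeasurable_snd, hzero, hlim.tendsto.congr fun ε ↦ ?_⟩
  exact Subtype.ext (hident ε).map_eq
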